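/- Let $\lambda$ be an uncountable cardinal and let $\chi\in\{2,\omega\}$. Let $\mathrm{NS}_{\lambda^+}$ be the collection of nonstationary subsets of $\lambda^+$, and let $E^{\lambda^+}_\theta=\{\alpha<\lambda^+\mid \mathrm{cf}(\alpha)=\theta\}$. We use the following notions. 1. $J_\chi[\lambda^+]$ is the collection of all $S\subseteq\lambda^+$ for which there are a club $C\subseteq\lambda^+$ and functions $f_i:\lambda^+\to[\lambda^+]^{<\chi}$ $(i<\lambda^+)$ such that for every $\alpha\in S\cap C$, every regressive $f:\alpha\to\alpha$ (that is, $f(\beta)<\beta$ for all nonzero $\beta<\alpha$) and every cofinal $B\subseteq\alpha$, there is $i<\alpha$ with $\sup\{\beta\in B\mid f(\beta)\in f_i(\beta)\}=\alpha$. 2. For a cardinal $\theta$, $m(\theta,\lambda,\theta,\chi)$ is the least size of a family $\mathcal H$ of functions from $\theta$ to $[\lambda]^{<\chi}$ such that for every $X\subseteq\theta$ with $|X|=\theta$ and every function $g:X\to\lambda$ there is $h\in\mathcal H$ with $|\{\xi\in X\mid g(\xi)\in h(\xi)\}|=\theta$. 3. For a map $d:\lambda^+\times\lambda^+\to\lambda$,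 $A(d)$ is the set of all $\alpha<\lambda^+$ such that for every cofinal $B\subseteq\alpha$ there are $\eta<\alpha$ and a set $B'\subseteq B$, cofinal in $\alpha$, on which $\beta\mapsto d(\eta,\beta)$ is injective. 4. A $\lambda^+$-complete ideal over $\lambda^+$ is a collection of subsets of $\lambda^+$ that contains $\emptyset$ and is closed under subsets and under unions of at most $\lambda$ of its members. Then $J_\chi[\lambda^+]$ is the $\lambda^+$-complete ideal generated by $$\{A(d)\cap E^{\lambda^+}_\theta\mid \theta<\lambda \text{ a cardinal with } m(\theta,\lambda,\theta,\chi)=\lambda,\ d:\lambda^+\times\lambda^+\to\lambda\}\cup\mathrm{NS}_{\lambda^+}.$$ That is, $J_\chi[\lambda^+]$ is a $\lambda^+$-complete ideal over $\lambda^+$, it includes this family, and it is contained in every $\lambda^+$-complete ideal over $\lambda^+$ that includes this family. -/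

import Mathlib

open Cardinal Order Set

universe u

/-- The well-ordered set of all ordinals below the initial ordinal of the cardinal `κ`,
that is, `κ` itself viewed as a von Neumann ordinal. -/
abbrev OrdBelow (κ : Cardinal.{u}) : Type u := κ.ord.ToType

/-- `B` is a cofinal subset of the ordinal `α`: `B ⊆ α` and every `γ < α` is bounded by some
`β ∈ B`. -/
def IsCofinalIn {κ : Cardinal.{u}} (B : Set (OrdBelow κ)) (α : OrdBelow κ) : Prop :=
  B ⊆ Iio α ∧ ∀ γ < α, ∃ β ∈ B, γ ≤ β

/-- `f` restricts to a regressive function from `α` to `α`: it maps `α` into `α`, and `f β < β`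
for all nonzero `β < α`. -/
def IsRegressiveOn {κ : Cardinal.{u}} (f : OrdBelow κ → OrdBelow κ) (α : OrdBelow κ) : Prop :=
  ∀ β < α, f β < α ∧ (¬ IsMin β → f β < β)

/-- `E^κ_θ`: the set of all `α < κ` of cofinality `θ`. -/
def cofSet (κ θ : Cardinal.{u}) : Set (OrdBelow κ) :=
  {α | Order.cof (Iio α) = θ}

/-- `NS_κ`: the collection of nonstationary subsets of `κ`. -/
def nonstationaryIdeal (κ : Cardinal.{u}) : Set (Set (OrdBelow κ)) :=
  {S | ¬ IsStationary S}

/-- `m(Δ, lam, θ, χ)`: the least size of a family `H` of functions from `Δ` to `[lam]^{<χ}` such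
that for every `X ⊆ Δ` of size `θ` and every function `g : X → lam` there is `h ∈ H` for which
`{ξ ∈ X | g ξ ∈ h ξ}` has size `θ`. -/
noncomputable def meetingNumber (Δ : Type u) (lam θ χ : Cardinal.{u}) : Cardinal.{u} :=
  sInf {c | ∃ H : Set (Δ → Set (OrdBelow lam)), #H = c ∧
    (∀ h ∈ H, ∀ ξ, #(h ξ) < χ) ∧
    ∀ X : Set Δ, #X = θ → ∀ g : X → OrdBelow lam,
      ∃ h ∈ H, #{ξ : X // g ξ ∈ h ξ} = θ}

/-- `J_χ[κ]`: the collection of all `S ⊆ κ` for which there are a club `C ⊆ κ` and functions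
`F i : κ → [κ]^{<χ}` for `i < κ` such that for all `α ∈ S ∩ C`, all regressive `f : α → α` and all
cofinal `B ⊆ α`, there is `i < α` with `sup {β ∈ B | f β ∈ F i β} = α`. -/
def regressiveIdeal (χ κ : Cardinal.{u}) : Set (Set (OrdBelow κ)) :=
  {S | ∃ C : Set (OrdBelow κ), IsClub C ∧
    ∃ F : OrdBelow κ → OrdBelow κ → Set (OrdBelow κ), (∀ i β, #(F i β) < χ) ∧
      ∀ α ∈ S ∩ C, ∀ f : OrdBelow κ → OrdBelow κ, IsRegressiveOn f α →
        ∀ B : Set (OrdBelow κ), IsCofinalIn B α →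
          ∃ i < α, IsLUB {β ∈ B | f β ∈ F i β} α}

/-- `A(d)`, for a map `d : κ × κ → lam`: the set of all `α < κ` such that for every cofinal
`B ⊆ α` there are `η < α` and a cofinal subset `B'` of `α` with `B' ⊆ B` on which
`β ↦ d (η, β)` is injective. -/
def injectivitySet {κ lam : Cardinal.{u}} (d : OrdBelow κ × OrdBelow κ → OrdBelow lam) :
    Set (OrdBelow κ) :=
  {α | ∀ B, IsCofinalIn B α →
    ∃ η < α, ∃ B', B' ⊆ B ∧ IsCofinalIn B' α ∧ InjOn (fun β => d (η, β)) B'}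

/-- `I` is a `μ`-complete ideal over `T`: it contains the empty set, is closed under subsets, and
is closed under unions of fewer than `μ` of its members. -/
structure IsCompleteIdeal {T : Type u} (μ : Cardinal.{u}) (I : Set (Set T)) : Prop where
  empty_mem : ∅ ∈ I
  subset_mem : ∀ S ∈ I, ∀ S' ⊆ S, S' ∈ I
  sUnion_mem : ∀ 𝒜 ⊆ I, #𝒜 < μ → ⋃₀ 𝒜 ∈ I

/-!
Let `λ` abbreviate `lam`, with `χ ≤ ω` throughout.

Suppose `m(θ, λ, θ, χ) = λ`. A meeting family of size `λ` on `θ` yields one of the same size on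
`λ`, by guessing twice: first an enumeration of the domain, which codes `θ` many of its points
injectively by ordinals below `θ`, and then the function on these codes. At `α ∈ A(d)` of
cofinality `θ`, some `d (η, ·)` codes a cofinal subset of any given `B` by `θ` many ordinals
below `λ`; injections of each `β` into `λ` code the values of a regressive function. Decoding the
meeting family therefore guesses regressive functions at `α`.

Conversely, fix `a` of size `λ`. Along a cofinal sequence of length `θ = cf(α)` above `a`, every
function into `a` is regressive, so a family that guesses regressive functions at `α` with fewer
than `λ⁺` indices reads as a meeting family of size at most `λ` on `θ`. Diagonalization shows that
such a family has size at least `λ`, whence `m(θ, λ, θ, χ) = λ`, and that there is none for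
`θ = λ`, whence `cf(α) < λ`. If `F i β` is the guess for the identity function of `θ`, let
`d (i, β)` bound the finite set `F i β ∩ θ`: a correct guess at `ξ` makes this at least `ξ`, so by
regularity of `θ` it takes `θ` many values, and `α ∈ A(d)`. There are at most `λ` cardinals
`θ < λ`, so `λ⁺`-completeness collects the resulting sets.
-/

section Clubs

variable {T : Type u} [LinearOrder T]

theorem bddAbove_of_mk_lt_cof {s : Set T} (hs : #s < cof T) : BddAbove s :=
  .of_not_isCofinal fun h ↦ (cof_le h).not_gt hs

theorem noMaxOrder_of_one_lt_cof (hT : 1 < cof T) : NoMaxOrder T :=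
  noTopOrder_iff_noMaxOrder _ |>.1 (cof_ne_one_iff.1 hT.ne')

theorem isClub_Ioi [NoMaxOrder T] (a : T) : IsClub (Ioi a) := by
  refine ⟨fun s hs ⟨x, hx⟩ _ b hb ↦ (hs hx).trans_le (hb.1 hx), fun b ↦ ?_⟩
  obtain ⟨c, hc⟩ := exists_gt (max a b)
  exact ⟨c, (le_max_left a b).trans_lt hc, (le_max_right a b).trans hc.le⟩

variable [WellFoundedLT T]

theorem exists_isLUB_of_bddAbove {s : Set T} (hs : BddAbove s) : ∃ c, IsLUB s c := by
  obtain ⟨c, hc, hmin⟩ := wellFounded_lt.has_min (upperBounds s) hs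
  exact ⟨c, hc, fun b hb ↦ not_lt.1 (hmin b hb)⟩

theorem isClub_setOf_forall_lt (hT : ℵ₀ < cof T) {h : T → T}
    (hh : ∀ a, BddAbove (h '' Iio a)) : IsClub {α | ∀ η < α, h η < α} := by
  have : NoMaxOrder T := noMaxOrder_of_one_lt_cof (one_lt_aleph0.trans hT)
  refine ⟨fun s hs _ _ α hα η hη ↦ ?_, fun a ↦ ?_⟩
  · obtain ⟨x, hx, hηx⟩ := (lt_isLUB_iff hα).1 hη
    exact (hs hx η hηx).trans_le (hα.1 hx)
  have next (x : T) : ∃ y, ∀ η < x, h η < y := by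
    obtain ⟨b, hb⟩ := hh x
    obtain ⟨y, hy⟩ := exists_gt b
    exact ⟨y, fun η hη ↦ (hb ⟨η, hη, rfl⟩).trans_lt hy⟩
  choose s hs using next
  obtain ⟨c, hc⟩ := exists_isLUB_of_bddAbove (s := range fun n ↦ s^[n] a)
    (bddAbove_of_mk_lt_cof ((countable_range _).le_aleph0.trans_lt hT))
  refine ⟨c, fun η hη ↦ ?_, hc.1 ⟨0, rfl⟩⟩
  obtain ⟨_, ⟨n, rfl⟩, hn⟩ := (lt_isLUB_iff hc).1 hη
  refine (hs _ η hn).trans_le (hc.1 ⟨n + 1, ?_⟩)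
  exact Function.iterate_succ_apply' s n a

theorem isClub_setOf_isSuccLimit (hT : ℵ₀ < cof T) : IsClub {α : T | IsSuccLimit α} := by
  have : NoMaxOrder T := noMaxOrder_of_one_lt_cof (one_lt_aleph0.trans hT)
  have : Nonempty T := cof_ne_zero_iff.1 (aleph0_pos.trans hT).ne'
  let := WellFoundedLT.toOrderBot T
  let := SuccOrder.ofLinearWellFoundedLT T
  have hsucc : IsClub {α : T | ∀ η < α, Order.succ η < α} :=
    isClub_setOf_forall_lt hT fun a ↦
      ⟨a, by rintro _ ⟨η, hη, rfl⟩; exact Order.succ_le_of_lt hη⟩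
  convert (isClub_Ioi (⊥ : T)).inter hT.ne' hsucc using 1
  ext α
  simp only [mem_ofPred_eq, mem_inter_iff, mem_Ioi, isSuccLimit_iff_of_orderBot,
    isSuccPrelimit_iff_succ_lt, bot_lt_iff_ne_bot]

end Clubs

section OrdBelow

variable {κ : Cardinal.{u}}

theorem mk_Iio_ordBelow_lt (α : OrdBelow κ) : #(Iio α) < κ :=
  (mk_Iio_lt α (by simp)).trans_eq (mk_ord_toType κ)

theorem exists_mk_Iio_ordBelow_eq {c : Cardinal.{u}} (hc : c < κ) :
    ∃ ζ : OrdBelow κ, #(Iio ζ) = c := by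
  let o : Iio κ.ord := ⟨c.ord, ord_lt_ord.2 hc⟩
  have htype : Ordinal.typein (α := OrdBelow κ) (· < ·) (Ordinal.ToType.mk o) = c.ord :=
    congrArg Subtype.val (Ordinal.ToType.mk.symm_apply_apply o)
  refine ⟨Ordinal.ToType.mk o, ?_⟩
  exact (Ordinal.card_typein (r := (· < · : OrdBelow κ → OrdBelow κ → Prop)) _).trans
    ((congrArg Ordinal.card htype).trans (card_ord c))

theorem nonempty_ordBelow (hκ : κ ≠ 0) : Nonempty (OrdBelow κ) := by
  rwa [← mk_ne_zero_iff, mk_ord_toType]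

theorem isCofinal_of_mk_eq {X : Set (OrdBelow κ)} (hX : #X = κ) : IsCofinal X := by
  by_contra h
  obtain ⟨ζ, hζ⟩ := not_isCofinal_iff.1 h
  exact ((mk_le_mk_of_subset (t := Iio ζ) hζ).trans_lt (mk_Iio_ordBelow_lt ζ)).ne hX

theorem cof_ordBelow_of_isRegular (hκ : κ.IsRegular) : cof (OrdBelow κ) = κ := by
  rw [Ordinal.cof_toType, hκ.cof_ord]

theorem isClub_setOf_forall_lt_of_isRegular (hκ : κ.IsRegular) (hκ₀ : ℵ₀ < κ)
    (h : OrdBelow κ → OrdBelow κ) : IsClub {α | ∀ η < α, h η < α} := by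
  have hcof := cof_ordBelow_of_isRegular hκ
  exact isClub_setOf_forall_lt (hκ₀.trans_eq hcof.symm) fun a ↦
    bddAbove_of_mk_lt_cof (mk_image_le.trans_lt ((mk_Iio_ordBelow_lt a).trans_eq hcof.symm))

end OrdBelow

section CofinalSets

variable {κ θ : Cardinal.{u}} {α : OrdBelow κ} {B : Set (OrdBelow κ)}

theorem isCofinalIn_Iio (α : OrdBelow κ) : IsCofinalIn (Iio α) α :=
  ⟨subset_rfl, fun γ hγ ↦ ⟨γ, hγ, le_rfl⟩⟩

theorem IsCofinalIn.mono {B' : Set (OrdBelow κ)} (hB : IsCofinalIn B α) (h : B ⊆ B')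
    (h' : B' ⊆ Iio α) : IsCofinalIn B' α :=
  ⟨h', fun γ hγ ↦ let ⟨β, hβ, hγβ⟩ := hB.2 γ hγ; ⟨β, h hβ, hγβ⟩⟩

theorem IsCofinalIn.inter_Ici (hB : IsCofinalIn B α) {a : OrdBelow κ} (ha : a < α) :
    IsCofinalIn (B ∩ Ici a) α :=
  ⟨fun _ hx ↦ hB.1 hx.1, fun γ hγ ↦
    let ⟨β, hβ, h⟩ := hB.2 (max γ a) (max_lt hγ ha)
    ⟨β, ⟨hβ, (le_max_right _ _).trans h⟩, (le_max_left _ _).trans h⟩⟩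

theorem IsCofinalIn.isLUB (hα : IsSuccLimit α) (hB : IsCofinalIn B α) : IsLUB B α := by
  refine ⟨fun x hx ↦ (hB.1 hx).le, fun b hb ↦ hα.le_iff_forall_le.2 fun x hx ↦ ?_⟩
  obtain ⟨β, hβ, hxβ⟩ := hB.2 x hx
  exact hxβ.trans (hb hβ)

theorem isCofinalIn_of_isLUB (hB : B ⊆ Iio α) (h : IsLUB B α) : IsCofinalIn B α :=
  ⟨hB, fun _ hγ ↦ let ⟨β, hβ, hγβ⟩ := (lt_isLUB_iff h).1 hγ; ⟨β, hβ, hγβ.le⟩⟩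

theorem aleph0_le_cof_Iio (hα : IsSuccLimit α) : ℵ₀ ≤ cof (Iio α) := by
  have := hα.nonempty_Iio.to_subtype
  have := hα.isSuccPrelimit.noMaxOrder_Iio
  exact aleph0_le_cof

theorem cofSet_mem_nonstationaryIdeal (hκ : κ.IsRegular) (hκ₀ : ℵ₀ < κ) (hθ : θ < ℵ₀) :
    cofSet κ θ ∈ nonstationaryIdeal κ :=
  not_isStationary_iff.2 ⟨{α | IsSuccLimit α},
    isClub_setOf_isSuccLimit (hκ₀.trans_eq (cof_ordBelow_of_isRegular hκ).symm),
    disjoint_left.2 fun _ hαθ hα ↦ (aleph0_le_cof_Iio hα).not_gt (hαθ.trans_lt hθ)⟩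

/-- `e` enumerates, increasingly and in order type `θ = cf(α)`, a cofinal subset of `α`. -/
structure IsCofinalSeq (e : OrdBelow θ → OrdBelow κ) (α : OrdBelow κ) : Prop where
  strictMono : StrictMono e
  isCofinalIn_range : IsCofinalIn (range e) α
  mem_cofSet : α ∈ cofSet κ θ

theorem IsCofinalIn.exists_isCofinalSeq (hB : IsCofinalIn B α) (hα : α ∈ cofSet κ θ) :
    ∃ e : OrdBelow θ → OrdBelow κ, IsCofinalSeq e α ∧ ∀ ξ, e ξ ∈ B := by
  have hB' : IsCofinal (Subtype.val ⁻¹' B : Set (Iio α)) := fun γ ↦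
    let ⟨β, hβ, h⟩ := hB.2 γ.1 γ.2
    ⟨⟨β, hB.1 hβ⟩, hβ, h⟩
  obtain ⟨t, htB, htcof, httype⟩ := Ordinal.exists_ord_cof_eq_of_isCofinal hB'
  rw [show cof (Iio α) = θ from hα, ← Ordinal.type_toType θ.ord] at httype
  obtain ⟨i⟩ := Ordinal.type_eq.1 httype
  refine ⟨fun ξ ↦ (i.symm ξ).1.1, ⟨fun x y h ↦ i.symm.map_rel_iff.2 h, ⟨?_, fun γ hγ ↦ ?_⟩, hα⟩,
    fun ξ ↦ htB (i.symm ξ).2⟩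
  · rintro _ ⟨ξ, rfl⟩
    exact (i.symm ξ).1.2
  · obtain ⟨β, hβ, h⟩ := htcof ⟨γ, hγ⟩
    exact ⟨β.1, ⟨i ⟨β, hβ⟩, by simp⟩, h⟩

theorem IsCofinalIn.exists_isCofinalSeq_ge (hB : IsCofinalIn B α) (hα : α ∈ cofSet κ θ)
    {a : OrdBelow κ} (ha : a < α) :
    ∃ e : OrdBelow θ → OrdBelow κ, IsCofinalSeq e α ∧ (∀ ξ, e ξ ∈ B) ∧ ∀ ξ, a ≤ e ξ := by
  obtain ⟨e, he, heB⟩ := (hB.inter_Ici ha).exists_isCofinalSeq hα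
  exact ⟨e, he, fun ξ ↦ (heB ξ).1, fun ξ ↦ (heB ξ).2⟩

theorem IsCofinalSeq.lt {e : OrdBelow θ → OrdBelow κ} (he : IsCofinalSeq e α) (ξ : OrdBelow θ) :
    e ξ < α :=
  he.isCofinalIn_range.1 ⟨ξ, rfl⟩

theorem IsCofinalSeq.isCofinalIn_image_iff {e : OrdBelow θ → OrdBelow κ} (he : IsCofinalSeq e α)
    {X : Set (OrdBelow θ)} : IsCofinalIn (e '' X) α ↔ #X = θ := by
  refine ⟨fun h ↦ ?_, fun h ↦ ⟨?_, fun γ hγ ↦ ?_⟩⟩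
  · have hcof : IsCofinal (range fun ξ : X ↦ (⟨e ξ, he.lt ξ⟩ : Iio α)) := fun γ ↦ by
      obtain ⟨_, ⟨ξ, hξ, rfl⟩, hle⟩ := h.2 γ.1 γ.2
      exact ⟨_, ⟨⟨ξ, hξ⟩, rfl⟩, hle⟩
    have hle : θ ≤ #X := he.mem_cofSet.symm.trans_le ((cof_le hcof).trans mk_range_le)
    exact ((mk_set_le X).trans_eq (mk_ord_toType θ)).antisymm hle
  · rintro _ ⟨ξ, -, rfl⟩
    exact he.lt ξ
  · obtain ⟨_, ⟨ζ, rfl⟩, hζ⟩ := he.isCofinalIn_range.2 γ hγ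
    obtain ⟨ξ, hξ, hζξ⟩ := isCofinal_of_mk_eq h ζ
    exact ⟨e ξ, ⟨ξ, hξ, rfl⟩, hζ.trans (he.strictMono.monotone hζξ)⟩

end CofinalSets

section CompleteIdeals

theorem IsCompleteIdeal.iUnion_mem {T ι : Type u} {μ : Cardinal.{u}} {I : Set (Set T)}
    (hI : IsCompleteIdeal μ I) (hι : #ι < μ) {S : ι → Set T} (hS : ∀ i, S i ∈ I) :
    ⋃ i, S i ∈ I :=
  sUnion_range S ▸ hI.sUnion_mem _ (range_subset_iff.2 hS) (mk_range_le.trans_lt hι)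

theorem IsCompleteIdeal.union_mem {T : Type u} {μ : Cardinal.{u}} {I : Set (Set T)}
    (hI : IsCompleteIdeal μ I) (hμ : ℵ₀ ≤ μ) {S S' : Set T} (hS : S ∈ I) (hS' : S' ∈ I) :
    S ∪ S' ∈ I :=
  sUnion_pair S S' ▸ hI.sUnion_mem _ (insert_subset hS (singleton_subset_iff.2 hS'))
    ((toFinite {S, S'}).lt_aleph0.trans_le hμ)

theorem IsCompleteIdeal.mem_of_forall_inter_cofSet_mem {κ lam μ : Cardinal.{u}}
    {I : Set (Set (OrdBelow κ))} (hI : IsCompleteIdeal μ I) (hμ : lam < μ)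
    {S : Set (OrdBelow κ)} (hS : ∀ α ∈ S, cof (Iio α) < lam)
    (h : ∀ θ < lam, S ∩ cofSet κ θ ∈ I) : S ∈ I := by
  refine hI.subset_mem _ (hI.iUnion_mem (ι := OrdBelow lam) (by rwa [mk_ord_toType])
    fun ζ ↦ h #(Iio ζ) (mk_Iio_ordBelow_lt ζ)) S fun α hα ↦ ?_
  obtain ⟨ζ, hζ⟩ := exists_mk_Iio_ordBelow_eq (hS α hα)
  exact mem_iUnion.2 ⟨ζ, hα, hζ.symm⟩

end CompleteIdeals

section Guessing

variable {κ χ : Cardinal.{u}} {α : OrdBelow κ}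

/-- Some index in `s` guesses correctly, cofinally often below `α`: for every regressive `f` on
`α` and every cofinal `B ⊆ α`, an `i ∈ s` satisfies `f β ∈ F i β` for cofinally many `β ∈ B`. -/
def GuessesAt {I : Type u} (F : I → OrdBelow κ → Set (OrdBelow κ)) (s : Set I)
    (α : OrdBelow κ) : Prop :=
  ∀ f : OrdBelow κ → OrdBelow κ, IsRegressiveOn f α → ∀ B : Set (OrdBelow κ), IsCofinalIn B α →
    ∃ i ∈ s, IsLUB {β ∈ B | f β ∈ F i β} α

theorem mem_regressiveIdeal_iff {S : Set (OrdBelow κ)} :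
    S ∈ regressiveIdeal χ κ ↔ ∃ C, IsClub C ∧ ∃ F : OrdBelow κ → OrdBelow κ → Set (OrdBelow κ),
      (∀ i β, #(F i β) < χ) ∧ ∀ α ∈ S ∩ C, GuessesAt F (Iio α) α :=
  Iff.rfl

theorem GuessesAt.reindex {I J : Type u} {F : I → OrdBelow κ → Set (OrdBelow κ)} {s : Set I}
    (hF : GuessesAt F s α) {G : J → OrdBelow κ → Set (OrdBelow κ)} {t : Set J} (c : I → J)
    (hc : ∀ i ∈ s, c i ∈ t ∧ G (c i) = F i) : GuessesAt G t α := fun f hf B hB ↦ by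
  obtain ⟨i, hi, hlub⟩ := hF f hf B hB
  exact ⟨c i, (hc i hi).1, (hc i hi).2 ▸ hlub⟩

theorem mem_regressiveIdeal_of_param (hκ : κ.IsRegular) (hκ₀ : ℵ₀ < κ) (hχ : χ ≠ 0) {P : Type u}
    (hP : #P < κ) {S C : Set (OrdBelow κ)} (hC : IsClub C)
    {F : P × OrdBelow κ → OrdBelow κ → Set (OrdBelow κ)} (hF : ∀ q β, #(F q β) < χ)
    (hG : ∀ α ∈ S ∩ C, GuessesAt F {q | q.2 < α} α) : S ∈ regressiveIdeal χ κ := by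
  have hcof := cof_ordBelow_of_isRegular hκ
  obtain ⟨c⟩ : #(P × OrdBelow κ) ≤ #(OrdBelow κ) := by
    rw [← mul_def, mk_ord_toType]
    exact mul_le_of_le hκ₀.le hP.le le_rfl
  have hclosed : IsClub (⋂ p, {α | ∀ η < α, c (p, η) < α}) :=
    .iInter (hcof.trans_ne hκ₀.ne') (by simpa [hcof] using hP) fun p ↦
      isClub_setOf_forall_lt_of_isRegular hκ hκ₀ fun η ↦ c (p, η)
  refine mem_regressiveIdeal_iff.2 ⟨_, hC.inter (hcof.trans_ne hκ₀.ne') hclosed,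
    Function.extend c F fun _ _ ↦ ∅, fun i β ↦ ?_, fun α ⟨hαS, hαC, hαc⟩ ↦ ?_⟩
  · by_cases hi : ∃ q, c q = i
    · obtain ⟨q, rfl⟩ := hi
      rw [c.injective.extend_apply]
      exact hF q β
    · rw [Function.extend_apply' _ _ _ hi]
      simpa [pos_iff_ne_zero] using hχ
  · exact (hG α ⟨hαS, hαC⟩).reindex c fun q hq ↦
      ⟨mem_iInter.1 hαc q.1 q.2 hq, c.injective.extend_apply _ _ _⟩

theorem nonstationaryIdeal_subset_regressiveIdeal (hχ : χ ≠ 0) (κ : Cardinal.{u}) :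
    nonstationaryIdeal κ ⊆ regressiveIdeal χ κ := fun _ hS ↦
  let ⟨C, hC, hdisj⟩ := not_isStationary_iff.1 hS
  ⟨C, hC, fun _ _ ↦ ∅, fun _ _ ↦ by simpa [pos_iff_ne_zero] using hχ,
    fun _ hα ↦ (disjoint_left.1 hdisj hα.1 hα.2).elim⟩

theorem isCompleteIdeal_regressiveIdeal (hκ : κ.IsRegular) (hκ₀ : ℵ₀ < κ) (hχ : χ ≠ 0) :
    IsCompleteIdeal κ (regressiveIdeal χ κ) where
  empty_mem := nonstationaryIdeal_subset_regressiveIdeal hχ κ not_isStationary_empty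
  subset_mem := fun _ ⟨C, hC, F, hF, h⟩ _ hS ↦
    ⟨C, hC, F, hF, fun α hα ↦ h α ⟨hS hα.1, hα.2⟩⟩
  sUnion_mem := fun 𝒜 h𝒜 hcard ↦ by
    choose C hC F hF hG using fun S : 𝒜 ↦ mem_regressiveIdeal_iff.1 (h𝒜 S.2)
    have hcof := cof_ordBelow_of_isRegular hκ
    have hCC : IsClub (⋂ S, C S) := .iInter (hcof.trans_ne hκ₀.ne') (by simpa [hcof]) hC
    refine mem_regressiveIdeal_of_param hκ hκ₀ hχ hcard hCC (F := fun q ↦ F q.1 q.2)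
      (fun q ↦ hF q.1 q.2) ?_
    rintro α ⟨⟨S, hS, hα⟩, hαC⟩
    exact (hG ⟨S, hS⟩ α ⟨hα, mem_iInter.1 hαC _⟩).reindex (fun i ↦ (⟨S, hS⟩, i))
      fun i hi ↦ ⟨hi, rfl⟩

end Guessing

section MeetingFamilies

/-- `H` is a family of functions from `Δ` to `[L]^{<χ}` such that every function to `L` from a
subset of `Δ` of size `θ` is met by some member of `H` at `θ` many points; `meetingNumber` is the
least size of such a family. -/
structure IsMeetingFamily {Δ L : Type u} (θ χ : Cardinal.{u}) (H : Set (Δ → Set L)) : Prop where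
  mk_lt : ∀ h ∈ H, ∀ ξ, #(h ξ) < χ
  exists_mk_eq : ∀ X : Set Δ, #X = θ → ∀ g : X → L, ∃ h ∈ H, #{ξ : X // g ξ ∈ h ξ} = θ

variable {Δ L : Type u} {lam θ χ : Cardinal.{u}}

theorem exists_isMeetingFamily (hlam : lam ≠ 0) (h : meetingNumber Δ lam θ χ = lam) :
    ∃ H : Set (Δ → Set (OrdBelow lam)), #H = lam ∧ IsMeetingFamily θ χ H := by
  have hne : {c | ∃ H : Set (Δ → Set (OrdBelow lam)), #H = c ∧ (∀ h ∈ H, ∀ ξ, #(h ξ) < χ) ∧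
      ∀ X : Set Δ, #X = θ → ∀ g : X → OrdBelow lam,
        ∃ h ∈ H, #{ξ : X // g ξ ∈ h ξ} = θ}.Nonempty := by
    by_contra hempty
    rw [meetingNumber, not_nonempty_iff_eq_empty.1 hempty, Cardinal.sInf_empty] at h
    exact hlam h.symm
  obtain ⟨H, hcard, hlt, hmeet⟩ := csInf_mem hne
  exact ⟨H, hcard.trans h, hlt, hmeet⟩

theorem exists_injOn_of_mk_le {α β : Type u} [Nonempty β] {s : Set α} (h : #s ≤ #β) :
    ∃ f : α → β, InjOn f s := by
  obtain ⟨a⟩ := h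
  refine ⟨Function.extend Subtype.val a fun _ ↦ Classical.arbitrary β, ?_⟩
  rw [injOn_iff_injective, domRestrict_eq, Function.extend_comp Subtype.val_injective]
  exact a.injective

theorem exists_forall_notMem (hL : ℵ₀ ≤ #L) {ι : Type u} (hι : #ι < #L) (t : ι → Set L)
    (ht : ∀ i, (t i).Finite) : ∃ x, ∀ i, x ∉ t i := by
  suffices h : #(⋃ i, t i) < #L by
    by_contra! hcover
    rw [eq_univ_of_forall fun x ↦ mem_iUnion.2 (hcover x), mk_univ] at h
    exact h.false
  rcases finite_or_infinite ι
  · exact (finite_iUnion ht).lt_aleph0.trans_le hL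
  · calc #(⋃ i, t i) ≤ sum fun i ↦ #(t i) := mk_iUnion_le_sum_mk
      _ ≤ sum fun _ : ι ↦ ℵ₀ := sum_le_sum _ _ fun i ↦ (ht i).lt_aleph0.le
      _ = #ι := by rw [sum_const', mul_aleph0_eq (aleph0_le_mk ι)]
      _ < #L := hι

namespace IsMeetingFamily

variable {H : Set (Δ → Set L)}

theorem finite (hH : IsMeetingFamily θ χ H) (hχ : χ ≤ ℵ₀) {h : Δ → Set L} (hh : h ∈ H) (ξ : Δ) :
    (h ξ).Finite :=
  lt_aleph0_iff_set_finite.1 ((hH.mk_lt h hh ξ).trans_le hχ)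

theorem meetingNumber_le {H : Set (Δ → Set (OrdBelow lam))} (hH : IsMeetingFamily θ χ H) :
    meetingNumber Δ lam θ χ ≤ #H :=
  csInf_le' ⟨H, rfl, hH.mk_lt, hH.exists_mk_eq⟩

theorem exists_mk_eq_of_injective (hH : IsMeetingFamily θ χ H) {D : Type u} (hD : #D = θ)
    {u : D → Δ} (hu : Function.Injective u) (g : D → L) :
    ∃ h ∈ H, #{ξ | g ξ ∈ h (u ξ)} = θ := by
  let v := Equiv.ofInjective u hu
  obtain ⟨h, hh, hcard⟩ := hH.exists_mk_eq (range u) ((mk_range_eq u hu).trans hD) (g ∘ v.symm)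
  refine ⟨h, hh, .trans (mk_congr (v.subtypeEquiv fun ξ ↦ ?_)) hcard⟩
  rw [mem_ofPred_eq, Function.comp_apply, v.symm_apply_apply, Equiv.ofInjective_apply]

theorem le_mk (hH : IsMeetingFamily θ χ H) (hχ : χ ≤ ℵ₀) (hL : ℵ₀ ≤ #L) (hθ : θ ≠ 0)
    (hΔ : θ ≤ #Δ) : #L ≤ #H := by
  by_contra! hlt
  choose g hg using fun ξ ↦ exists_forall_notMem hL hlt (fun h ↦ h.1 ξ) fun h ↦ hH.finite hχ h.2 ξ
  obtain ⟨X, hX⟩ := le_mk_iff_exists_set.1 hΔ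
  obtain ⟨h, hh, hcard⟩ := hH.exists_mk_eq X hX fun ξ ↦ g ξ
  obtain ⟨ξ⟩ := mk_ne_zero_iff.1 (hcard.trans_ne hθ)
  exact hg ξ.1 ⟨h, hh⟩ ξ.2

theorem le_meetingNumber {H : Set (Δ → Set (OrdBelow lam))} (hH : IsMeetingFamily θ χ H)
    (hχ : χ ≤ ℵ₀) (hlam : ℵ₀ ≤ lam) (hθ : θ ≠ 0) (hΔ : θ ≤ #Δ) :
    lam ≤ meetingNumber Δ lam θ χ := by
  have hL := mk_ord_toType lam
  refine le_csInf ⟨_, H, rfl, hH.mk_lt, hH.exists_mk_eq⟩ ?_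
  rintro _ ⟨H', rfl, hlt, hmeet⟩
  exact hL.ge.trans (le_mk ⟨hlt, hmeet⟩ hχ (hlam.trans_eq hL.symm) hθ hΔ)

theorem lt_mk {H : Set (OrdBelow lam → Set L)} (hH : IsMeetingFamily lam χ H) (hχ : χ ≤ ℵ₀)
    (hlam : ℵ₀ ≤ lam) (hL : #L = lam) : lam < #H := by
  by_contra! hle
  obtain ⟨s⟩ : #H ≤ #(OrdBelow lam) := by rwa [mk_ord_toType]
  have hfew (ξ : OrdBelow lam) : #{h // s h < ξ} < #L :=
    (mk_preimage_of_injective s (Iio ξ) s.injective).trans_lt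
      ((mk_Iio_ordBelow_lt ξ).trans_eq hL.symm)
  choose g hg using fun ξ ↦ exists_forall_notMem (hlam.trans_eq hL.symm) (hfew ξ)
    (fun h ↦ h.1.1 ξ) fun h ↦ hH.finite hχ h.1.2 ξ
  obtain ⟨h, hh, hcard⟩ :=
    hH.exists_mk_eq_of_injective (mk_ord_toType lam) Function.injective_id g
  have := Cardinal.noMaxOrder hlam
  obtain ⟨ζ, hζ⟩ := exists_gt (s ⟨h, hh⟩)
  obtain ⟨ξ, hξ, hζξ⟩ := isCofinal_of_mk_eq hcard ζ
  exact hg ξ ⟨⟨h, hh⟩, hζ.trans_le hζξ⟩ hξ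

theorem exists_injOn (hH : IsMeetingFamily θ χ H) (hχ : χ ≤ ℵ₀) (hθ : ℵ₀ ≤ θ) (hΔ : #Δ = θ) :
    ∃ a : H → L → Δ, ∀ (D : Type u) (u : D → L), #D = θ → Function.Injective u →
      ∃ (h : H) (Z : Set D), #Z = θ ∧ InjOn (a h ∘ u) Z := by
  have : Nonempty Δ := mk_ne_zero_iff.1 (hΔ.trans_ne (aleph0_pos.trans_le hθ).ne')
  have hle (h : H) : #(⋃ ξ, h.1 ξ) ≤ #Δ :=
    calc #(⋃ ξ, h.1 ξ) ≤ sum fun ξ ↦ #(h.1 ξ) := mk_iUnion_le_sum_mk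
      _ ≤ sum fun _ : Δ ↦ ℵ₀ := sum_le_sum _ _ fun ξ ↦ (hH.finite hχ h.2 ξ).lt_aleph0.le
      _ = #Δ := by rw [sum_const', mul_aleph0_eq (hθ.trans_eq hΔ.symm)]
  choose a ha using fun h ↦ exists_injOn_of_mk_le (hle h)
  refine ⟨a, fun D u hD hu ↦ ?_⟩
  obtain ⟨v⟩ := Cardinal.eq.1 (hD.trans hΔ.symm)
  obtain ⟨h, hh, hcard⟩ := hH.exists_mk_eq_of_injective hD v.injective u
  refine ⟨⟨h, hh⟩, _, hcard, (ha ⟨h, hh⟩).comp hu.injOn fun ξ hξ ↦ ?_⟩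
  exact mem_iUnion.2 ⟨v ξ, hξ⟩

theorem exists_codomain_family (hH : IsMeetingFamily θ χ H) (hχ : χ ≤ ℵ₀) (hθ : ℵ₀ ≤ θ)
    (hΔ : #Δ = θ) : ∃ K : Set (L → Set L), #K ≤ #H * #H ∧ IsMeetingFamily θ χ K := by
  obtain ⟨a, ha⟩ := hH.exists_injOn hχ hθ hΔ
  refine ⟨range fun p : H × H ↦ p.2.1 ∘ a p.1, mk_range_le.trans_eq (mul_def _ _).symm, ⟨?_, ?_⟩⟩
  · rintro _ ⟨p, rfl⟩ x
    exact hH.mk_lt _ p.2.2 _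
  intro X hX g
  obtain ⟨h, Z, hZ, hinj⟩ := ha X Subtype.val hX Subtype.val_injective
  obtain ⟨h', hh', hcard⟩ :=
    hH.exists_mk_eq_of_injective hZ (injOn_iff_injective.1 hinj) fun z ↦ g z
  refine ⟨_, ⟨(h, ⟨h', hh'⟩), rfl⟩, ((mk_set_le _).trans_eq hX).antisymm ?_⟩
  exact hcard.symm.trans_le <| mk_le_of_injective (f := fun z ↦ ⟨z.1.1, z.2⟩) fun z w hzw ↦
    Subtype.ext (Subtype.ext (Subtype.mk.inj hzw))

end IsMeetingFamily

end MeetingFamilies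

section InjectivitySets

variable {κ lam θ χ : Cardinal.{u}}

/-- The guess for the value at `β` of a regressive function that the guessing function `h` on
`lam` induces when `β` is coded by `d (η, β)` and its predecessors `γ` are coded by `E β γ`. -/
def decodedGuess (E : OrdBelow κ → OrdBelow κ → OrdBelow lam)
    (d : OrdBelow κ × OrdBelow κ → OrdBelow lam) (h : OrdBelow lam → Set (OrdBelow lam))
    (η β : OrdBelow κ) : Set (OrdBelow κ) :=
  {γ | γ < β ∧ E β γ ∈ h (d (η, β))}

theorem mk_decodedGuess_le {E : OrdBelow κ → OrdBelow κ → OrdBelow lam} {β : OrdBelow κ}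
    (hE : InjOn (E β) (Iio β)) (d : OrdBelow κ × OrdBelow κ → OrdBelow lam)
    (h : OrdBelow lam → Set (OrdBelow lam)) (η : OrdBelow κ) :
    #(decodedGuess E d h η β) ≤ #(h (d (η, β))) := by
  rw [← mk_image_eq_of_injOn (E β) _ (hE.mono fun _ hγ ↦ hγ.1)]
  exact mk_le_mk_of_subset (image_subset_iff.2 fun _ hγ ↦ hγ.2)

theorem guessesAt_of_mem_injectivitySet {K : Set (OrdBelow lam → Set (OrdBelow lam))}
    (hK : IsMeetingFamily θ χ K) (E : OrdBelow κ → OrdBelow κ → OrdBelow lam)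
    {d : OrdBelow κ × OrdBelow κ → OrdBelow lam} {α : OrdBelow κ} (hα : IsSuccLimit α)
    (hαd : α ∈ injectivitySet d) (hαθ : α ∈ cofSet κ θ) :
    GuessesAt (fun q : K × OrdBelow κ ↦ decodedGuess E d q.1 q.2) {q | q.2 < α} α := by
  intro f hf B hB
  obtain ⟨x, hx⟩ := hα.nonempty_Iio
  obtain ⟨y, hxy, hy⟩ := hα.lt_iff_exists_lt.1 hx
  obtain ⟨η, hη, B', hB'B, hB', hinj⟩ := hαd _ (hB.inter_Ici hxy)
  obtain ⟨e, he, heB'⟩ := hB'.exists_isCofinalSeq hαθ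
  have heB (ξ) : e ξ ∈ B ∩ Ici y := hB'B (heB' ξ)
  have hcode : Function.Injective fun ξ ↦ d (η, e ξ) := fun ξ ζ h ↦
    he.strictMono.injective (hinj (heB' ξ) (heB' ζ) h)
  obtain ⟨k, hk, hcard⟩ :=
    hK.exists_mk_eq_of_injective (mk_ord_toType θ) hcode fun ξ ↦ E (e ξ) (f (e ξ))
  refine ⟨(⟨k, hk⟩, η), hη, IsCofinalIn.isLUB hα ((he.isCofinalIn_image_iff.2 hcard).mono ?_ ?_)⟩
  · rintro _ ⟨ξ, hξ, rfl⟩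
    have hlt : f (e ξ) < e ξ := (hf _ (he.lt ξ)).2 (not_isMin_of_lt (hy.trans_le (heB ξ).2))
    exact ⟨(heB ξ).1, hlt, hξ⟩
  · exact fun β hβ ↦ hB.1 hβ.1

theorem injectivitySet_inter_cofSet_mem (hlam : ℵ₀ ≤ lam) (hχ₀ : χ ≠ 0) (hχ : χ ≤ ℵ₀)
    (hm : meetingNumber (OrdBelow θ) lam θ χ = lam)
    (d : OrdBelow (succ lam) × OrdBelow (succ lam) → OrdBelow lam) :
    injectivitySet d ∩ cofSet (succ lam) θ ∈ regressiveIdeal χ (succ lam) := by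
  have hreg : (succ lam).IsRegular := isRegular_succ hlam
  have hunc : ℵ₀ < succ lam := hlam.trans_lt (lt_succ lam)
  have hlam₀ : lam ≠ 0 := (aleph0_pos.trans_le hlam).ne'
  rcases lt_or_ge θ ℵ₀ with hθ | hθ
  · exact (isCompleteIdeal_regressiveIdeal hreg hunc hχ₀).subset_mem _
      (nonstationaryIdeal_subset_regressiveIdeal hχ₀ _
        (cofSet_mem_nonstationaryIdeal hreg hunc hθ)) _ inter_subset_right
  obtain ⟨H, hHcard, hH⟩ := exists_isMeetingFamily hlam₀ hm
  obtain ⟨K, hKcard, hK⟩ := hH.exists_codomain_family hχ hθ (mk_ord_toType θ)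
  have hKlam : #K ≤ lam := by rwa [hHcard, mul_eq_self hlam] at hKcard
  have := nonempty_ordBelow hlam₀
  choose E hE using fun β : OrdBelow (succ lam) ↦
    exists_injOn_of_mk_le (β := OrdBelow lam) (s := Iio β) (by
      rw [mk_ord_toType]
      exact lt_succ_iff.1 (mk_Iio_ordBelow_lt β))
  refine mem_regressiveIdeal_of_param hreg hunc hχ₀ (lt_succ_of_le hKlam)
    (isClub_setOf_isSuccLimit (hunc.trans_eq (cof_ordBelow_of_isRegular hreg).symm))
    (fun q β ↦ (mk_decodedGuess_le (hE β) d q.1 q.2).trans_lt (hK.mk_lt _ q.1.2 _)) ?_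
  exact fun α hα ↦ guessesAt_of_mem_injectivitySet hK E hα.2 hα.1.1 hα.1.2

end InjectivitySets

section Generation

variable {κ lam θ χ : Cardinal.{u}} {a α : OrdBelow κ}

theorem exists_isRegressiveOn_extension {I : Type u} (ha : a < α) {e : I → OrdBelow κ}
    (he : Function.Injective e) (hae : ∀ i, a ≤ e i) (g : I → Iio a) :
    ∃ f, IsRegressiveOn f α ∧ ∀ i, f (e i) = g i := by
  have : Nonempty (OrdBelow κ) := ⟨a⟩
  let := WellFoundedLT.toOrderBot (OrdBelow κ)
  refine ⟨Function.extend e (fun i ↦ g i) fun _ ↦ ⊥, fun β hβ ↦ ?_,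
    fun i ↦ he.extend_apply _ _ i⟩
  by_cases h : ∃ i, e i = β
  · obtain ⟨i, rfl⟩ := h
    rw [he.extend_apply]
    exact ⟨(g i).2.trans ha, fun _ ↦ (g i).2.trans_le (hae i)⟩
  · rw [Function.extend_apply' _ _ _ h]
    exact ⟨bot_le.trans_lt hβ, fun hmin ↦ bot_lt_iff_ne_bot.2 fun h ↦ hmin (h ▸ isMin_bot)⟩

section GuessesAt

variable {L I : Type u} {F : I → OrdBelow κ → Set (OrdBelow κ)} {s : Set I}
  {e : OrdBelow θ → OrdBelow κ}

theorem GuessesAt.isMeetingFamily (hG : GuessesAt F s α) (hF : ∀ i β, #(F i β) < χ)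
    (he : IsCofinalSeq e α) (ha : a < α) (hae : ∀ ξ, a ≤ e ξ) (ι : L ↪ Iio a) :
    IsMeetingFamily θ χ ((fun i ξ ↦ {x : L | (ι x : OrdBelow κ) ∈ F i (e ξ)}) '' s) := by
  refine ⟨?_, fun X hX g ↦ ?_⟩
  · rintro _ ⟨i, -, rfl⟩ ξ
    exact (mk_preimage_of_injective (fun x ↦ (ι x : OrdBelow κ)) _
      (Subtype.val_injective.comp ι.injective)).trans_lt (hF i (e ξ))
  obtain ⟨f, hf, hfg⟩ := exists_isRegressiveOn_extension ha
    (he.strictMono.injective.comp Subtype.val_injective) (fun ξ : X ↦ hae ξ) fun ξ ↦ ι (g ξ)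
  obtain ⟨i, hi, hlub⟩ := hG f hf (e '' X) (he.isCofinalIn_image_iff.2 hX)
  refine ⟨_, ⟨i, hi, rfl⟩, ?_⟩
  have hsub : {β ∈ e '' X | f β ∈ F i β} ⊆ Iio α := by
    rintro _ ⟨⟨ξ, -, rfl⟩, -⟩
    exact he.lt ξ
  have hY : e '' (Subtype.val '' {ξ : X | (ι (g ξ) : OrdBelow κ) ∈ F i (e ξ)}) =
      {β ∈ e '' X | f β ∈ F i β} := by
    ext β
    constructor
    · rintro ⟨_, ⟨ξ, hξ, rfl⟩, rfl⟩
      exact ⟨⟨ξ, ξ.2, rfl⟩, mem_of_eq_of_mem (hfg ξ) hξ⟩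
    · rintro ⟨⟨ξ, hξ, rfl⟩, h⟩
      exact ⟨ξ, ⟨⟨ξ, hξ⟩, (hfg ⟨ξ, hξ⟩).subst (motive := (· ∈ F i (e ξ))) h, rfl⟩, rfl⟩
  refine (mk_image_eq Subtype.val_injective).symm.trans (he.isCofinalIn_image_iff.1 ?_)
  exact hY ▸ isCofinalIn_of_isLUB hsub hlub

theorem GuessesAt.meetingNumber_eq (hG : GuessesAt F s α) (hF : ∀ i β, #(F i β) < χ)
    (hχ : χ ≤ ℵ₀) (hlam : ℵ₀ ≤ lam) (hs : #s ≤ lam) (hα : α ∈ cofSet κ θ) (hθ : θ ≠ 0)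
    (ha : a < α) (ι : OrdBelow lam ↪ Iio a) : meetingNumber (OrdBelow θ) lam θ χ = lam := by
  obtain ⟨e, he, -, hae⟩ := (isCofinalIn_Iio α).exists_isCofinalSeq_ge hα ha
  have hH := hG.isMeetingFamily hF he ha hae ι
  refine (hH.meetingNumber_le.trans (mk_image_le.trans hs)).antisymm ?_
  exact hH.le_meetingNumber hχ hlam hθ (mk_ord_toType θ).ge

theorem GuessesAt.cof_ne (hG : GuessesAt F s α) (hF : ∀ i β, #(F i β) < χ) (hχ : χ ≤ ℵ₀)
    (hlam : ℵ₀ ≤ lam) (hs : #s ≤ lam) (ha : a < α) (ι : OrdBelow lam ↪ Iio a) :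
    cof (Iio α) ≠ lam := fun hα ↦ by
  obtain ⟨e, he, -, hae⟩ := (isCofinalIn_Iio α).exists_isCofinalSeq_ge hα ha
  have hH := hG.isMeetingFamily hF he ha hae ι
  exact (hH.lt_mk hχ hlam (mk_ord_toType lam)).not_ge (mk_image_le.trans hs)

end GuessesAt

theorem exists_injOn_of_forall_le {c : Cardinal.{u}} (hc : cof (OrdBelow c) = c)
    {Z : Set (OrdBelow c)} (hZ : #Z = c) {m : OrdBelow c → OrdBelow c}
    (hm : ∀ ξ ∈ Z, ξ ≤ m ξ) : ∃ Z' ⊆ Z, #Z' = c ∧ InjOn m Z' := by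
  obtain ⟨Z', hZ', hbij⟩ := (surjOn_image m Z).exists_bijOn_subset
  have hcofinal : IsCofinal (m '' Z) := fun ζ ↦
    let ⟨ξ, hξ, h⟩ := isCofinal_of_mk_eq hZ ζ
    ⟨m ξ, ⟨ξ, hξ, rfl⟩, h.trans (hm ξ hξ)⟩
  refine ⟨Z', hZ', ((mk_set_le Z').trans_eq (mk_ord_toType c)).antisymm ?_, hbij.injOn⟩
  calc c = cof (OrdBelow c) := hc.symm
    _ ≤ #(m '' Z) := cof_le hcofinal
    _ = #Z' := by rw [← hbij.image_eq, mk_image_eq_of_injOn _ _ hbij.injOn]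

theorem exists_injectivitySet_of_guessesAt {F : OrdBelow κ → OrdBelow κ → Set (OrdBelow κ)}
    (hF : ∀ i β, #(F i β) < χ) (hχ : χ ≤ ℵ₀) (hθ : θ ≠ 0) (j : OrdBelow θ ↪ OrdBelow lam)
    (ι : OrdBelow θ ↪ Iio a) :
    ∃ d : OrdBelow κ × OrdBelow κ → OrdBelow lam,
      ∀ α ∈ cofSet κ θ, a < α → GuessesAt F (Iio α) α → α ∈ injectivitySet d := by
  have := nonempty_ordBelow hθ
  have hι : Function.Injective fun ξ ↦ (ι ξ : OrdBelow κ) :=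
    Subtype.val_injective.comp ι.injective
  have hbdd (i β) : BddAbove {ξ | (ι ξ : OrdBelow κ) ∈ F i β} :=
    Finite.bddAbove <| lt_aleph0_iff_set_finite.1 <|
      (mk_preimage_of_injective _ _ hι).trans_lt ((hF i β).trans_le hχ)
  choose m hm using hbdd
  refine ⟨fun p ↦ j (m p.1 p.2), fun α hα ha hG B hB ↦ ?_⟩
  obtain ⟨e, he, heB, hae⟩ := hB.exists_isCofinalSeq_ge hα ha
  obtain ⟨_, ⟨i, hi, rfl⟩, hcard⟩ := (hG.isMeetingFamily hF he ha hae ι).exists_mk_eq_of_injective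
    (mk_ord_toType θ) Function.injective_id id
  have hreg : cof (OrdBelow θ) = θ := by
    rw [Ordinal.cof_toType, ← show cof (Iio α) = θ from hα, cof_ord_cof]
  obtain ⟨Z, -, hZ, hinj⟩ := exists_injOn_of_forall_le hreg hcard
    (m := fun ξ ↦ m i (e ξ)) fun ξ hξ ↦ hm i (e ξ) hξ
  refine ⟨i, hi, e '' Z, ?_, he.isCofinalIn_image_iff.2 hZ, ?_⟩
  · rintro _ ⟨ξ, -, rfl⟩
    exact heB ξ
  · exact InjOn.image_of_comp (j.injective.comp_injOn hinj)

theorem regressiveIdeal_subset (hlam : ℵ₀ ≤ lam) (hχ : χ ≤ ℵ₀)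
    {I : Set (Set (OrdBelow (succ lam)))} (hI : IsCompleteIdeal (succ lam) I)
    (hns : nonstationaryIdeal (succ lam) ⊆ I)
    (hinj : ∀ θ < lam, meetingNumber (OrdBelow θ) lam θ χ = lam →
      ∀ d : OrdBelow (succ lam) × OrdBelow (succ lam) → OrdBelow lam,
        injectivitySet d ∩ cofSet (succ lam) θ ∈ I) :
    regressiveIdeal χ (succ lam) ⊆ I := by
  intro S hS
  obtain ⟨C, hC, F, hF, hG⟩ := mem_regressiveIdeal_iff.1 hS
  have hreg : (succ lam).IsRegular := isRegular_succ hlam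
  have hunc : ℵ₀ < succ lam := hlam.trans_lt (lt_succ lam)
  have hcof := hunc.trans_eq (cof_ordBelow_of_isRegular hreg).symm
  have hmk (α : OrdBelow (succ lam)) : #(Iio α) ≤ lam := lt_succ_iff.1 (mk_Iio_ordBelow_lt α)
  obtain ⟨a, ha⟩ := exists_mk_Iio_ordBelow_eq (lt_succ lam)
  obtain ⟨ι⟩ := Cardinal.eq.1 ((mk_ord_toType lam).trans ha.symm)
  have := noMaxOrder_of_one_lt_cof (one_lt_aleph0.trans hcof)
  have hD : IsClub (C ∩ Ioi a) := hC.inter hcof.ne' (isClub_Ioi a)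
  have hnot : S \ (C ∩ Ioi a) ∈ I := hns (not_isStationary_iff.2 ⟨_, hD, disjoint_sdiff_left⟩)
  refine inter_union_sdiff S (C ∩ Ioi a) ▸ hI.union_mem hunc.le ?_ hnot
  refine hI.mem_of_forall_inter_cofSet_mem (lt_succ lam) (fun α hα ↦ ?_) fun θ hθ ↦ ?_
  · exact ((cof_le_cardinalMk _).trans (hmk α)).lt_of_ne
      ((hG α ⟨hα.1, hα.2.1⟩).cof_ne hF hχ hlam (hmk α) hα.2.2 ι.toEmbedding)
  rcases lt_or_ge θ ℵ₀ with hfin | hinf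
  · exact hI.subset_mem _ (hns (cofSet_mem_nonstationaryIdeal hreg hunc hfin)) _
      inter_subset_right
  rcases (S ∩ (C ∩ Ioi a) ∩ cofSet (succ lam) θ).eq_empty_or_nonempty with
    hempty | ⟨α, hα, hαθ⟩
  · exact hempty ▸ hI.empty_mem
  have hθ₀ : θ ≠ 0 := (aleph0_pos.trans_le hinf).ne'
  have hm := (hG α ⟨hα.1, hα.2.1⟩).meetingNumber_eq hF hχ hlam (hmk α) hαθ hθ₀ hα.2.2
    ι.toEmbedding
  obtain ⟨j⟩ : #(OrdBelow θ) ≤ #(OrdBelow lam) := by simpa only [mk_ord_toType] using hθ.le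
  obtain ⟨d, hd⟩ :=
    exists_injectivitySet_of_guessesAt hF hχ hθ₀ j (j.trans ι.toEmbedding)
  exact hI.subset_mem _ (hinj θ hθ hm d) _ fun β hβ ↦
    ⟨hd β hβ.2 hβ.1.2.2 (hG β ⟨hβ.1.1, hβ.1.2.1⟩), hβ.2⟩

end Generation

theorem mainTheorem5_general (lam : Cardinal.{u}) (hlam : ℵ₀ ≤ lam)
    (χ : Cardinal.{u}) (hχ₀ : χ ≠ 0) (hχ : χ ≤ ℵ₀) :
    IsLeast
      {I : Set (Set (OrdBelow (Order.succ lam))) |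
        IsCompleteIdeal (Order.succ lam) I ∧
        {S | ∃ θ : Cardinal.{u}, θ < lam ∧ meetingNumber (OrdBelow θ) lam θ χ = lam ∧
            ∃ d : OrdBelow (Order.succ lam) × OrdBelow (Order.succ lam) → OrdBelow lam,
              S = injectivitySet d ∩ cofSet (Order.succ lam) θ}
          ∪ nonstationaryIdeal (Order.succ lam) ⊆ I}
      (regressiveIdeal χ (Order.succ lam)) := by
  have hreg : (succ lam).IsRegular := isRegular_succ hlam
  refine ⟨⟨isCompleteIdeal_regressiveIdeal hreg (hlam.trans_lt (lt_succ lam)) hχ₀, union_subset ?_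
    (nonstationaryIdeal_subset_regressiveIdeal hχ₀ _)⟩, fun I ⟨hI, hsub⟩ ↦ ?_⟩
  · rintro _ ⟨θ, -, hm, d, rfl⟩
    exact injectivitySet_inter_cofSet_mem hlam hχ₀ hχ hm d
  · exact regressiveIdeal_subset hlam hχ hI (fun S hS ↦ hsub (.inr hS)) fun θ hθ hm d ↦
      hsub (.inl ⟨θ, hθ, hm, d, rfl⟩)

theorem mainTheorem5 (lam : Cardinal.{u}) (hlam : ℵ₀ < lam)
    (χ : Cardinal.{u}) (hχ : χ = 2 ∨ χ = ℵ₀) :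
    IsLeast
      {I : Set (Set (OrdBelow (Order.succ lam))) |
        IsCompleteIdeal (Order.succ lam) I ∧
        {S | ∃ θ : Cardinal.{u}, θ < lam ∧ meetingNumber (OrdBelow θ) lam θ χ = lam ∧
            ∃ d : OrdBelow (Order.succ lam) × OrdBelow (Order.succ lam) → OrdBelow lam,
              S = injectivitySet d ∩ cofSet (Order.succ lam) θ}
          ∪ nonstationaryIdeal (Order.succ lam) ⊆ I}
      (regressiveIdeal χ (Order.succ lam)) := by
  rcases hχ with rfl | rfl
  exacts [mainTheorem5_general lam hlam.le 2 two_ne_zero ofNat_le_aleph0,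
    mainTheorem5_general lam hlam.le ℵ₀ aleph0_ne_zero le_rfl]
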